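/- Fix an integer $a\ge 2$. The $a$-shuffle distribution $P_{n,a}$ on the symmetric group $S_n$ is defined as follows. Cut a deck of cards labelled $1,\dots,n$ from top to bottom into $a$ consecutive piles of sizes $b_1,\dots,b_a\ge 0$ with $b_1+\dots+b_a=n$, the sizes $(b_1,\dots,b_a)$ being chosen with probability $\binom{n}{b_1,\dots,b_a}a^{-n}$; then choose uniformly one of the $\binom{n}{b_1,\dots,b_a}$ ways of interleaving the piles, leaving the cards of each pile in their original order. Then $\rho(i)$ is the label of the card in position $i$ of the resulting deck. For $\rho\in S_n$ let $$\mathrm{inv}(\rho)=\#\{(i,j): 1\le i\le j\le n,\ \rho(i)>\rho(j)\}.$$ Theorem. For every $n$ let $\rho_{n,a}$ be a random permutation with distribution $P_{n,a}$. Then $$\frac{\mathrm{inv}(\rho_{n,a})-\frac{n(n-1)}{4}\,\frac{a-1}{a}}{\sqrt{n}\,(n-1)\,\sqrt{\frac{a^2-1}{36a^2}}}\ \longrightarrow_d\ \mathcal{G}\qquad\text{as } n\to\infty,$$ where $\mathcal{G}$ is a standard normal random variable and $\longrightarrow_d$ denotes convergence in distribution. -/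

import Mathlib

open MeasureTheory ProbabilityTheory Filter

noncomputable section

/-- A permutation of `n` cards is an element of a finite discrete space. -/
instance permFinMeasurableSpace (n : ℕ) : MeasurableSpace (Equiv.Perm (Fin n)) := ⊤

/-- The number of inversions of a finite sequence. -/
def invCount {n : ℕ} {α : Type*} [LinearOrder α] (x : Fin n → α) : ℕ :=
  (Finset.univ.filter fun q : Fin n × Fin n => q.1 ≤ q.2 ∧ x q.2 < x q.1).card

/-- The law of the pile sizes when an `n`-card deck is cut into `a` piles: the multinomial
distribution with `n` trials and cell probabilities `p`, which gives the sizes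
`b` with `∑ i, b i = n` probability `multinomial(n; b) * ∏ i, p i ^ b i`. -/
def cutLaw (n a : ℕ) (p : PMF (Fin a)) : PMF (Fin a → ℕ) :=
  PMF.ofFinset
    (fun b => if b ∈ Finset.piAntidiag Finset.univ n then
      (Nat.multinomial Finset.univ b : ENNReal) * ∏ i, p i ^ b i else 0)
    (Finset.piAntidiag Finset.univ n)
    (by
      rw [Finset.sum_congr rfl fun b hb => if_pos hb, ← Finset.sum_pow_eq_sum_piAntidiag,
        ← tsum_fintype (L := .unconditional _), p.tsum_coe, one_pow])
    (fun _ hb => if_neg hb)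

/-- When a deck whose cards are labelled `0, …, n - 1` from top to bottom is cut into consecutive
piles of sizes `b 0, b 1, …`, the card `x` lands in the pile `k`. -/
def InPile {n a : ℕ} (b : Fin a → ℕ) (k : Fin a) (x : Fin n) : Prop :=
  ∑ j ∈ Finset.Iio k, b j ≤ (x : ℕ) ∧ (x : ℕ) < ∑ j ∈ Finset.Iic k, b j

instance {n a : ℕ} (b : Fin a → ℕ) (k : Fin a) (x : Fin n) : Decidable (InPile b k x) :=
  inferInstanceAs (Decidable (_ ∧ _))

/-- The decks that can be obtained by interleaving the piles of sizes `b`. Here `ρ i` is the card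
at position `i` of the shuffled deck, so `ρ.symm x` is the position of the card `x`; cards
of the same pile stay in their original order. -/
def interleavings (n : ℕ) {a : ℕ} (b : Fin a → ℕ) : Finset (Equiv.Perm (Fin n)) :=
  Finset.univ.filter fun ρ =>
    ∀ (k : Fin a) (x y : Fin n), InPile b k x → InPile b k y → x < y → ρ.symm x < ρ.symm y

theorem interleavings_nonempty (n : ℕ) {a : ℕ} (b : Fin a → ℕ) : (interleavings n b).Nonempty :=
  ⟨Equiv.refl _, Finset.mem_filter.2 ⟨Finset.mem_univ _, fun _ _ _ _ _ h => h⟩⟩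

/-- The `p`-shuffle distribution on the permutations of `n` cards: cut the deck
into `a` piles with multinomial sizes, then choose one of the interleavings uniformly. -/
def pShuffle (n a : ℕ) (p : PMF (Fin a)) : PMF (Equiv.Perm (Fin n)) :=
  (cutLaw n a p).bind fun b =>
    PMF.uniformOfFinset (interleavings n b) (interleavings_nonempty n b)

/-- The `a`-shuffle distribution: the `p`-shuffle distribution with `p` uniform. -/
def aShuffle (n a : ℕ) [NeZero a] : PMF (Equiv.Perm (Fin n)) :=
  pShuffle n a (PMF.uniformOfFintype (Fin a))

end

/-! Write under each position of the shuffled deck the pile its card came from. This turns an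
`a`-shuffle into a uniformly random word of length n in a letters, and the permutation is recovered
as the inverse of the stable sort of the word (`aShuffle_eq_map_sort`). Stability means ties create
no inversion, so the inversion numbers agree (`invCount_sort_symm`) and the problem concerns
independent uniform letters.

The inversion number of a word is a U-statistic-like sum over pairs i < j. Its Hoeffding
decomposition (`invCount_word_eq`) consists of the mean, a linear part ∑ (n - 1 - 2i) c(w i) in
centred letters c, and a degenerate remainder. Distinct terms of the remainder are uncorrelated, so
its L² norm is O(n) (`sum_sq_degenerate_le`), negligible against the scale n^(3/2). The linear part
has independent summands and variance n(n² - 1)/3 · (a² - 1)/(12a²), asymptotic to the square of the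
normalisation. Its characteristic function is a product, compared factor by factor with Gaussian
exponentials by Taylor expansion (`norm_prod_uniformCharFun_sub_exp_le`). Convergence of
characteristic functions then gives convergence in distribution. -/

/-! ### Shuffles and words -/

/-- The words of length `n` in the letters `Fin a` in which the letter `k` occurs `b k` times. -/
def wordsOfContent (n : ℕ) {a : ℕ} (b : Fin a → ℕ) : Finset (Fin n → Fin a) :=
  Finset.univ.filter fun w => ∀ k, (Finset.univ.filter fun i => w i = k).card = b k

/-- Expand (∑ X_k)^n both word by word and by the multinomial theorem, and compare the coefficients
of the monomial with exponent `b`. -/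
theorem card_wordsOfContent {n a : ℕ} {b : Fin a → ℕ}
    (hb : b ∈ Finset.piAntidiag Finset.univ n) :
    (wordsOfContent n b).card = Nat.multinomial Finset.univ b := by
  classical
  have hb' : ∑ i, b i = n := (Finset.mem_piAntidiag.1 hb).1
  have hmon : ∀ c : Fin a → ℕ, (∏ k, (MvPolynomial.X k : MvPolynomial (Fin a) ℕ) ^ c k) =
      MvPolynomial.monomial (Finsupp.equivFunOnFinite.symm c) 1 := by
    intro c
    rw [MvPolynomial.monomial_eq, Finsupp.prod_fintype _ _ (by simp)]
    simp
  have key : ∑ w : Fin n → Fin a, ∏ k, (MvPolynomial.X k : MvPolynomial (Fin a) ℕ) ^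
        (Finset.univ.filter fun i => w i = k).card =
      ∑ c ∈ Finset.piAntidiag Finset.univ n, (Nat.multinomial Finset.univ c : MvPolynomial (Fin a) ℕ) *
        ∏ k, (MvPolynomial.X k : MvPolynomial (Fin a) ℕ) ^ c k := by
    rw [← Finset.sum_pow_eq_sum_piAntidiag, Fintype.sum_pow]
    refine Finset.sum_congr rfl fun w _ => ?_
    rw [← Finset.prod_fiberwise (s := Finset.univ) (g := w)]
    refine Finset.prod_congr rfl fun k _ => ?_
    rw [Finset.prod_congr rfl (g := fun _ => MvPolynomial.X k)
      (fun i hi => by rw [(Finset.mem_filter.1 hi).2]), Finset.prod_const]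
  have := congrArg (MvPolynomial.coeff (Finsupp.equivFunOnFinite.symm b)) key
  simp only [hmon, MvPolynomial.coeff_sum, ← MvPolynomial.C_eq_coe_nat, MvPolynomial.coeff_C_mul,
    MvPolynomial.coeff_monomial, EmbeddingLike.apply_eq_iff_eq] at this
  simp only [mul_ite, mul_one, mul_zero, Finset.sum_ite_eq', if_pos hb] at this
  rw [Finset.sum_boole] at this
  simpa [wordsOfContent, funext_iff] using this

/-- The sorted word is monotone, so the letter `k` fills a block of positions whose ends are the
partial sums of `b`, exactly as the piles do. -/
theorem inPile_iff_apply_sort {n a : ℕ} {b : Fin a → ℕ} {w : Fin n → Fin a}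
    (hw : w ∈ wordsOfContent n b) (k : Fin a) (x : Fin n) :
    InPile b k x ↔ w (Tuple.sort w x) = k := by
  have hc : ∀ k, (Finset.univ.filter fun i => w i = k).card = b k := (Finset.mem_filter.1 hw).2
  have hcount : ∀ s : Finset (Fin a),
      (Finset.univ.filter fun i => w (Tuple.sort w i) ∈ s).card = ∑ j ∈ s, b j := by
    intro s
    have h1 : (Finset.univ.filter fun i => w (Tuple.sort w i) ∈ s).card =
        (Finset.univ.filter fun i => w i ∈ s).card := by
      refine Finset.card_bij (fun i _ => Tuple.sort w i) (by simp) (by simp) fun i hi => ?_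
      exact ⟨(Tuple.sort w).symm i, by simpa using hi, by simp⟩
    rw [h1, Finset.card_eq_sum_card_fiberwise (f := w) (t := s) (fun i hi => by simpa using hi)]
    refine Finset.sum_congr rfl fun j hj => ?_
    rw [← hc j, Finset.filter_filter]
    congr 1
    ext i
    simp only [Finset.mem_filter, Finset.mem_univ, true_and]
    exact ⟨fun h => h.2, fun h => ⟨h ▸ hj, h⟩⟩
  have hle := Tuple.lt_card_le_iff_apply_le_of_monotone (j := x) (a := k) (Tuple.monotone_sort w)
  have hlt := Tuple.lt_card_lt_iff_apply_lt_of_monotone (j := x) (a := k) (Tuple.monotone_sort w)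
  have h1 := hcount (Finset.Iic k)
  have h2 := hcount (Finset.Iio k)
  simp only [Finset.mem_Iic, Finset.mem_Iio] at h1 h2
  simp only [Function.comp_apply, h1, h2] at hle hlt
  rw [InPile, ← not_lt, hlt, hle, not_lt, le_antisymm_iff, and_comm]

theorem sort_symm_mem_interleavings {n a : ℕ} {b : Fin a → ℕ} {w : Fin n → Fin a}
    (hw : w ∈ wordsOfContent n b) : (Tuple.sort w).symm ∈ interleavings n b := by
  refine Finset.mem_filter.2 ⟨Finset.mem_univ _, fun k x y hx hy hxy => ?_⟩
  rw [inPile_iff_apply_sort hw] at hx hy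
  exact (Tuple.eq_sort_iff.1 (rfl : Tuple.sort w = _)).2 x y hxy (hx.trans hy.symm)

/-- The letter `w i` can be read off as the pile containing the card at position `i`. -/
theorem sort_symm_injOn (n : ℕ) {a : ℕ} (b : Fin a → ℕ) :
    Set.InjOn (fun w : Fin n → Fin a => (Tuple.sort w).symm) (wordsOfContent n b) := by
  intro w hw v hv h
  have hs : Tuple.sort w = Tuple.sort v := by simpa using congrArg Equiv.symm h
  funext i
  have h1 := (inPile_iff_apply_sort hw (w i) ((Tuple.sort w).symm i)).2 (by simp)
  rw [inPile_iff_apply_sort hv, hs] at h1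
  simpa using h1.symm

theorem image_sort_symm_wordsOfContent {n a : ℕ} {b : Fin a → ℕ}
    (hb : b ∈ Finset.piAntidiag Finset.univ n) :
    (wordsOfContent n b).image (fun w => (Tuple.sort w).symm) = interleavings n b := by
  ext σ
  rw [Finset.mem_image]
  constructor
  · rintro ⟨w, hw, rfl⟩
    exact sort_symm_mem_interleavings hw
  intro hσ
  have hσ' := (Finset.mem_filter.1 hσ).2
  -- Any word of content `b` names the piles: card `x` lies in pile `v (Tuple.sort v x)`. The
  -- preimage of `σ` is then the word of piles read along the shuffled deck.
  obtain ⟨v, hv⟩ : (wordsOfContent n b).Nonempty := by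
    rw [← Finset.card_pos, card_wordsOfContent hb]
    exact Nat.multinomial_pos _ _
  have hp : ∀ x, InPile b (v (Tuple.sort v x)) x := fun x => (inPile_iff_apply_sort hv _ x).2 rfl
  refine ⟨fun i => v (Tuple.sort v (σ i)), ?_, ?_⟩
  · refine Finset.mem_filter.2 ⟨Finset.mem_univ _, fun k => ?_⟩
    rw [← (Finset.mem_filter.1 hv).2 k]
    refine Finset.card_bij (fun i _ => Tuple.sort v (σ i)) (by simp) (by simp) fun i hi => ?_
    exact ⟨σ.symm ((Tuple.sort v).symm i), by simpa using hi, by simp⟩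
  · have : σ.symm = Tuple.sort fun i => v (Tuple.sort v (σ i)) := by
      refine Tuple.eq_sort_iff.2 ⟨?_, fun x y hxy h => ?_⟩
      · have : (fun i => v (Tuple.sort v (σ i))) ∘ σ.symm = v ∘ Tuple.sort v := by
          funext x; simp
        rw [this]
        exact Tuple.monotone_sort v
      · refine hσ' _ x y (hp x) ?_ hxy
        have h' : v (Tuple.sort v x) = v (Tuple.sort v y) := by simpa using h
        rw [h']
        exact hp y
    rw [← this]; simp

theorem card_interleavings {n a : ℕ} {b : Fin a → ℕ}
    (hb : b ∈ Finset.piAntidiag Finset.univ n) :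
    (interleavings n b).card = Nat.multinomial Finset.univ b := by
  rw [← image_sort_symm_wordsOfContent hb, Finset.card_image_of_injOn (sort_symm_injOn n b),
    card_wordsOfContent hb]

theorem content_mem_piAntidiag {n a : ℕ} (w : Fin n → Fin a) :
    (fun k => (Finset.univ.filter fun i => w i = k).card) ∈ Finset.piAntidiag Finset.univ n := by
  refine Finset.mem_piAntidiag.2 ⟨?_, by simp⟩
  rw [← Finset.card_eq_sum_card_fiberwise (f := w) (s := Finset.univ) (t := Finset.univ) (by simp)]
  simp

/-- The `a`-shuffle distribution is the law of the permutation which labels the positions in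
the order of the stable sort of a uniformly random word. -/
theorem aShuffle_eq_map_sort (n a : ℕ) [NeZero a] :
    aShuffle n a =
      (PMF.uniformOfFintype (Fin n → Fin a)).map fun w => (Tuple.sort w).symm := by
  classical
  ext σ
  rw [PMF.map_apply, aShuffle, pShuffle, PMF.bind_apply]
  rw [tsum_eq_sum (s := Finset.piAntidiag Finset.univ n)
    (fun b hb => by rw [cutLaw, PMF.ofFinset_apply, if_neg hb, zero_mul]), tsum_fintype]
  simp only [PMF.uniformOfFintype_apply (α := Fin n → Fin a)]
  -- The multinomial coefficient in the cut probability cancels the number of interleavings, leaving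
  -- weight a^(-n) for each word.
  have h1 : ∀ b ∈ Finset.piAntidiag Finset.univ n,
      cutLaw n a (PMF.uniformOfFintype (Fin a)) b *
        PMF.uniformOfFinset (interleavings n b) (interleavings_nonempty n b) σ =
      ∑ w ∈ wordsOfContent n b, if σ = (Tuple.sort w).symm then
        (Fintype.card (Fin n → Fin a) : ENNReal)⁻¹ else 0 := by
    intro b hb
    have hb' : ∑ i, b i = n := (Finset.mem_piAntidiag.1 hb).1
    rw [← Finset.sum_image (f := fun τ => if σ = τ then
      (Fintype.card (Fin n → Fin a) : ENNReal)⁻¹ else 0) (sort_symm_injOn n b),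
      image_sort_symm_wordsOfContent hb, Finset.sum_ite_eq, PMF.uniformOfFinset_apply,
      card_interleavings hb]
    split_ifs with h
    · simp only [cutLaw, PMF.ofFinset_apply, if_pos hb, PMF.uniformOfFintype_apply,
        Finset.prod_pow_eq_pow_sum, hb', Fintype.card_fin, Fintype.card_fun]
      rw [mul_comm, ← mul_assoc, ENNReal.inv_mul_cancel, one_mul, Nat.cast_pow, ENNReal.inv_pow]
      · exact_mod_cast (Nat.multinomial_pos _ _).ne'
      · exact ENNReal.natCast_ne_top _
    · simp
  rw [Finset.sum_congr rfl h1, ← Finset.sum_fiberwise_of_maps_to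
    (g := fun (w : Fin n → Fin a) k => (Finset.univ.filter fun i => w i = k).card)
    (t := Finset.piAntidiag Finset.univ n) fun w _ => content_mem_piAntidiag w]
  refine Finset.sum_congr rfl fun b _ => Finset.sum_congr ?_ fun _ _ => rfl
  ext w
  simp [wordsOfContent, funext_iff]

theorem invCount_sort_symm {n : ℕ} {α : Type*} [LinearOrder α] (w : Fin n → α) :
    invCount (Tuple.sort w).symm = invCount w := by
  unfold invCount
  congr 1
  refine Finset.filter_congr fun q _ => and_congr_right fun hq => ⟨fun h => ?_, fun h => ?_⟩
  · have hm : w q.2 ≤ w q.1 := by simpa using Tuple.monotone_sort w h.le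
    refine hm.lt_of_ne fun he => ?_
    have := (Tuple.eq_sort_iff.1 (rfl : Tuple.sort w = _)).2 _ _ h (by simpa using he)
    simp only [Equiv.apply_symm_apply] at this
    exact absurd hq (not_le.2 this)
  · by_contra hn
    have := Tuple.monotone_sort w (not_lt.1 hn)
    simp only [Function.comp_apply, Equiv.apply_symm_apply] at this
    exact absurd h (not_lt.2 this)

/-! ### Degenerate second-order statistics of words -/

section Words

variable {ι α : Type*} [Fintype ι] [DecidableEq ι] [Fintype α]

theorem sum_eq_zero_of_sum_update_eq_zero {F : (ι → α) → ℝ} (j : ι)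
    (h : ∀ w, ∑ x, F (Function.update w j x) = 0) : ∑ w, F w = 0 := by
  classical
  rw [← (Equiv.funSplitAt j α).symm.sum_comp, Fintype.sum_prod_type_right]
  refine Finset.sum_eq_zero fun r _ => ?_
  rcases isEmpty_or_nonempty α with hα | ⟨⟨x₀⟩⟩
  · simp
  rw [← h ((Equiv.funSplitAt j α).symm (x₀, r))]
  refine Finset.sum_congr rfl fun x _ => congrArg F ?_
  funext i
  rcases eq_or_ne i j with rfl | hij
  · simp [Equiv.funSplitAt, Equiv.piSplitAt]
  · simp [Equiv.funSplitAt, Equiv.piSplitAt, hij]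

/-- An index occurring in only one of the two factors can be summed out first, which kills the
product. -/
theorem sum_mul_eq_zero_of_degenerate {h : α → α → ℝ} (h₁ : ∀ y, ∑ x, h x y = 0)
    (h₂ : ∀ x, ∑ y, h x y = 0) {i j : ι} (hij : i ≠ j) {k l : ι}
    (hne : (i ≠ k ∧ i ≠ l) ∨ (j ≠ k ∧ j ≠ l)) :
    ∑ w : ι → α, h (w i) (w j) * h (w k) (w l) = 0 := by
  rcases hne with ⟨hk, hl⟩ | ⟨hk, hl⟩
  · refine sum_eq_zero_of_sum_update_eq_zero i fun w => ?_
    simp only [Function.update_self, Function.update_of_ne hij.symm, Function.update_of_ne hk.symm,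
      Function.update_of_ne hl.symm]
    rw [← Finset.sum_mul, h₁, zero_mul]
  · refine sum_eq_zero_of_sum_update_eq_zero j fun w => ?_
    simp only [Function.update_self, Function.update_of_ne hij, Function.update_of_ne hk.symm,
      Function.update_of_ne hl.symm]
    rw [← Finset.sum_mul, h₂, zero_mul]

/-- The ordered pairs of positions `i < j`. -/
def increasingPairs (n : ℕ) : Finset (Fin n × Fin n) :=
  Finset.univ.filter fun p => p.1 < p.2

/-- Only diagonal terms of the expanded square survive, so the remainder has size of order n
although it has of order n² terms. -/
theorem sum_sq_degenerate_le {n : ℕ} {h : α → α → ℝ} (h₁ : ∀ y, ∑ x, h x y = 0)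
    (h₂ : ∀ x, ∑ y, h x y = 0) {M : ℝ} (hM : ∀ x y, |h x y| ≤ M) :
    ∑ w : Fin n → α, (∑ p ∈ increasingPairs n, h (w p.1) (w p.2)) ^ 2 ≤
      (Fintype.card α : ℝ) ^ n * ((n : ℝ) * M) ^ 2 := by
  classical
  have hsq : ∀ x y, h x y * h x y ≤ M ^ 2 := fun x y => by
    rw [← sq, ← sq_abs]; exact pow_le_pow_left₀ (abs_nonneg _) (hM x y) 2
  calc ∑ w : Fin n → α, (∑ p ∈ increasingPairs n, h (w p.1) (w p.2)) ^ 2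
      = ∑ p ∈ increasingPairs n, ∑ q ∈ increasingPairs n,
          ∑ w : Fin n → α, h (w p.1) (w p.2) * h (w q.1) (w q.2) := by
        simp_rw [sq, Finset.sum_mul_sum]
        rw [Finset.sum_comm]
        exact Finset.sum_congr rfl fun p _ => Finset.sum_comm
    _ = ∑ p ∈ increasingPairs n, ∑ w : Fin n → α, h (w p.1) (w p.2) * h (w p.1) (w p.2) := by
        refine Finset.sum_congr rfl fun p hp => Finset.sum_eq_single_of_mem p hp fun q hq hqp => ?_
        have hp' : p.1 < p.2 := (Finset.mem_filter.1 hp).2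
        have hq' : q.1 < q.2 := (Finset.mem_filter.1 hq).2
        refine sum_mul_eq_zero_of_degenerate h₁ h₂ hp'.ne ?_
        -- If both indices of `p` occur in `q`, the two pairs coincide, since both are increasing.
        by_contra hcon
        refine hqp (Prod.ext ?_ ?_) <;> grind
    _ ≤ ∑ p ∈ increasingPairs n, ∑ w : Fin n → α, M ^ 2 :=
        Finset.sum_le_sum fun p _ => Finset.sum_le_sum fun w _ => hsq _ _
    _ = (increasingPairs n).card * ((Fintype.card α : ℝ) ^ n * M ^ 2) := by simp
    _ ≤ (n : ℝ) ^ 2 * ((Fintype.card α : ℝ) ^ n * M ^ 2) := by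
        gcongr
        have : (increasingPairs n).card ≤ n * n :=
          (Finset.card_le_univ _).trans (by simp)
        rw [sq]
        exact_mod_cast this
    _ = _ := by ring

theorem cast_card_Ioi_fin {n : ℕ} (i : Fin n) :
    ((Finset.Ioi i).card : ℝ) = (n : ℝ) - 1 - (i : ℕ) := by
  have := i.2
  rw [Fin.card_Ioi, Nat.sub_sub, Nat.cast_sub (by omega)]
  push_cast
  ring

theorem sum_increasingPairs_fst {n : ℕ} (f : Fin n → ℝ) :
    ∑ p ∈ increasingPairs n, f p.1 = ∑ i : Fin n, ((n : ℝ) - 1 - (i : ℕ)) * f i := by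
  rw [increasingPairs, Finset.sum_filter, Fintype.sum_prod_type]
  refine Finset.sum_congr rfl fun i _ => ?_
  dsimp only
  rw [← Finset.sum_filter, Finset.sum_const, Finset.filter_lt_eq_Ioi, nsmul_eq_mul, cast_card_Ioi_fin]

theorem sum_increasingPairs_snd {n : ℕ} (f : Fin n → ℝ) :
    ∑ p ∈ increasingPairs n, f p.2 = ∑ i : Fin n, ((i : ℕ) : ℝ) * f i := by
  rw [increasingPairs, Finset.sum_filter, Fintype.sum_prod_type_right]
  refine Finset.sum_congr rfl fun i _ => ?_
  dsimp only
  rw [← Finset.sum_filter, Finset.sum_const, Finset.filter_gt_eq_Iio, Fin.card_Iio, nsmul_eq_mul]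

end Words

/-! ### Hoeffding decomposition of the inversion number -/

theorem sum_range_natCast (n : ℕ) : ∑ i ∈ Finset.range n, (i : ℝ) = (n : ℝ) * ((n : ℝ) - 1) / 2 := by
  induction n with
  | zero => simp
  | succ n ih => rw [Finset.sum_range_succ, ih]; push_cast; ring

theorem sum_range_natCast_sq (n : ℕ) :
    ∑ i ∈ Finset.range n, (i : ℝ) ^ 2 = (n : ℝ) * ((n : ℝ) - 1) * (2 * n - 1) / 6 := by
  induction n with
  | zero => simp
  | succ n ih => rw [Finset.sum_range_succ, ih]; push_cast; ring

theorem card_increasingPairs (n : ℕ) :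
    ((increasingPairs n).card : ℝ) = (n : ℝ) * ((n : ℝ) - 1) / 2 := by
  have := sum_increasingPairs_snd (n := n) fun _ => 1
  rw [Finset.sum_const, nsmul_eq_mul, mul_one] at this
  rw [this]
  simp only [mul_one]
  rw [Fin.sum_univ_eq_sum_range (fun i => (i : ℝ)), sum_range_natCast]

/-- The letter `x` of `Fin a`, centred and scaled by `1 / a`. -/
noncomputable def centeredLetter {a : ℕ} (x : Fin a) : ℝ := ((x : ℕ) - ((a : ℝ) - 1) / 2) / a

/-- The doubly centred indicator of a descent. -/
noncomputable def descentRemainder {a : ℕ} (x y : Fin a) : ℝ :=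
  (if y < x then 1 else 0) - ((a : ℝ) - 1) / (2 * a) - centeredLetter x + centeredLetter y

section Letters

variable {a : ℕ}

theorem abs_centeredLetter_le (x : Fin a) : |centeredLetter x| ≤ 1 / 2 := by
  have ha : (0 : ℝ) < a := by exact_mod_cast x.pos
  have h1 : ((x : ℕ) : ℝ) + 1 ≤ a := by exact_mod_cast x.2
  have h0 : (0 : ℝ) ≤ (x : ℕ) := by positivity
  rw [centeredLetter, abs_div, abs_of_pos ha, div_le_iff₀ ha, abs_le]
  constructor <;> linarith

theorem sum_centeredLetter : ∑ x : Fin a, centeredLetter x = 0 := by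
  simp only [centeredLetter]
  rw [← Finset.sum_div, Finset.sum_sub_distrib, Fin.sum_univ_eq_sum_range (fun i => (i : ℝ)),
    sum_range_natCast]
  simp only [Finset.sum_const, Finset.card_univ, Fintype.card_fin, nsmul_eq_mul]
  ring

theorem sum_centeredLetter_sq [NeZero a] :
    ∑ x : Fin a, centeredLetter x ^ 2 = a * (((a : ℝ) ^ 2 - 1) / (12 * (a : ℝ) ^ 2)) := by
  have ha : (a : ℝ) ≠ 0 := NeZero.ne _
  simp only [centeredLetter, div_pow, sub_sq]
  rw [← Finset.sum_div, Finset.sum_add_distrib, Finset.sum_sub_distrib, ← Finset.sum_mul,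
    ← Finset.mul_sum, Fin.sum_univ_eq_sum_range (fun i => (i : ℝ)),
    Fin.sum_univ_eq_sum_range (fun i => (i : ℝ) ^ 2), sum_range_natCast, sum_range_natCast_sq]
  simp only [Finset.sum_const, Finset.card_univ, Fintype.card_fin, nsmul_eq_mul]
  field_simp
  ring

/-- For uniform `x`, a descent has probability (a - 1 - y)/a, which is the mean (a - 1)/(2a) minus
`centeredLetter y`. -/
theorem sum_descentRemainder_left (y : Fin a) : ∑ x, descentRemainder x y = 0 := by
  have ha : (a : ℝ) ≠ 0 := by exact_mod_cast y.pos.ne'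
  have hc : (∑ x : Fin a, if y < x then (1 : ℝ) else 0) = (a : ℝ) - 1 - (y : ℕ) := by
    rw [Finset.sum_boole, Finset.filter_lt_eq_Ioi, cast_card_Ioi_fin]
  simp only [descentRemainder]
  rw [Finset.sum_add_distrib, Finset.sum_sub_distrib, Finset.sum_sub_distrib, sum_centeredLetter, hc]
  simp only [Finset.sum_const, Finset.card_univ, Fintype.card_fin, nsmul_eq_mul, centeredLetter]
  field_simp
  ring

theorem sum_descentRemainder_right (x : Fin a) : ∑ y, descentRemainder x y = 0 := by
  have ha : (a : ℝ) ≠ 0 := by exact_mod_cast x.pos.ne'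
  have hc : (∑ y : Fin a, if y < x then (1 : ℝ) else 0) = (x : ℕ) := by
    rw [Finset.sum_boole, Finset.filter_gt_eq_Iio, Fin.card_Iio]
  simp only [descentRemainder]
  rw [Finset.sum_add_distrib, Finset.sum_sub_distrib, Finset.sum_sub_distrib, sum_centeredLetter, hc]
  simp only [Finset.sum_const, Finset.card_univ, Fintype.card_fin, nsmul_eq_mul, centeredLetter]
  field_simp
  ring

theorem abs_descentRemainder_le (x y : Fin a) : |descentRemainder x y| ≤ 3 := by
  have ha : (1 : ℝ) ≤ a := by exact_mod_cast x.pos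
  have h1 := abs_le.1 (abs_centeredLetter_le x)
  have h2 := abs_le.1 (abs_centeredLetter_le y)
  have h3 : 0 ≤ ((a : ℝ) - 1) / (2 * a) := div_nonneg (by linarith) (by linarith)
  have h4 : ((a : ℝ) - 1) / (2 * a) ≤ 1 := by rw [div_le_one (by linarith)]; linarith
  rw [descentRemainder, abs_le]
  split_ifs <;> constructor <;> linarith

/-- The Hoeffding decomposition of the number of inversions of a word. -/
theorem invCount_word_eq {n : ℕ} (w : Fin n → Fin a) :
    (invCount w : ℝ) - (n : ℝ) * ((n : ℝ) - 1) / 4 * (((a : ℝ) - 1) / a) =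
      ∑ i : Fin n, ((n : ℝ) - 1 - 2 * (i : ℕ)) * centeredLetter (w i) +
        ∑ p ∈ increasingPairs n, descentRemainder (w p.1) (w p.2) := by
  have h1 : (invCount w : ℝ) = ∑ p ∈ increasingPairs n, if w p.2 < w p.1 then (1 : ℝ) else 0 := by
    rw [Finset.sum_boole, invCount, increasingPairs, Finset.filter_filter]
    congr 2
    refine Finset.filter_congr fun q _ => ⟨fun h => ⟨h.1.lt_of_ne fun he => ?_, h.2⟩,
      fun h => ⟨h.1.le, h.2⟩⟩
    have := h.2
    rw [he] at this
    exact this.false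
  simp only [descentRemainder]
  rw [Finset.sum_add_distrib, Finset.sum_sub_distrib, Finset.sum_sub_distrib, ← h1,
    sum_increasingPairs_fst fun i => centeredLetter (w i),
    sum_increasingPairs_snd fun i => centeredLetter (w i), Finset.sum_const, nsmul_eq_mul,
    card_increasingPairs]
  -- Position i is first in n - 1 - i pairs and second in i pairs; the opposite signs give the
  -- weight n - 1 - 2i.
  have h2 : ∑ i : Fin n, ((n : ℝ) - 1 - 2 * (i : ℕ)) * centeredLetter (w i) =
      ∑ i : Fin n, ((n : ℝ) - 1 - (i : ℕ)) * centeredLetter (w i) -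
        ∑ i : Fin n, ((i : ℕ) : ℝ) * centeredLetter (w i) := by
    rw [← Finset.sum_sub_distrib]
    exact Finset.sum_congr rfl fun i _ => by ring
  rw [h2, ← div_div]
  ring

end Letters

/-! ### Characteristic functions -/

theorem norm_prod_sub_prod_le {ι R : Type*} [NormedCommRing R] [NormOneClass R] (s : Finset ι)
    {f g : ι → R} (hf : ∀ i ∈ s, ‖f i‖ ≤ 1) (hg : ∀ i ∈ s, ‖g i‖ ≤ 1) :
    ‖∏ i ∈ s, f i - ∏ i ∈ s, g i‖ ≤ ∑ i ∈ s, ‖f i - g i‖ := by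
  classical
  induction s using Finset.induction_on with
  | empty => simp
  | insert j s hj ih =>
    rw [Finset.prod_insert hj, Finset.prod_insert hj, Finset.sum_insert hj]
    have ih' := ih (fun i hi => hf i (Finset.mem_insert_of_mem hi))
      (fun i hi => hg i (Finset.mem_insert_of_mem hi))
    have hP : ‖∏ i ∈ s, f i‖ ≤ 1 :=
      (Finset.norm_prod_le _ _).trans (Finset.prod_le_one (fun _ _ => norm_nonneg _)
        fun i hi => hf i (Finset.mem_insert_of_mem hi))
    have hgj := hg j (Finset.mem_insert_self _ _)
    calc ‖f j * ∏ i ∈ s, f i - g j * ∏ i ∈ s, g i‖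
        = ‖(f j - g j) * ∏ i ∈ s, f i + g j * (∏ i ∈ s, f i - ∏ i ∈ s, g i)‖ := by
          congr 1; ring
      _ ≤ ‖f j - g j‖ * ‖∏ i ∈ s, f i‖ + ‖g j‖ * ‖∏ i ∈ s, f i - ∏ i ∈ s, g i‖ :=
          (norm_add_le _ _).trans (add_le_add (norm_mul_le _ _) (norm_mul_le _ _))
      _ ≤ ‖f j - g j‖ * 1 + 1 * ∑ i ∈ s, ‖f i - g i‖ := by gcongr
      _ = _ := by ring

theorem norm_exp_mul_I_sub_exp_mul_I_le (x y : ℝ) :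
    ‖Complex.exp (x * Complex.I) - Complex.exp (y * Complex.I)‖ ≤ |x - y| := by
  have h : Complex.exp (x * Complex.I) - Complex.exp (y * Complex.I) =
      Complex.exp (y * Complex.I) * (Complex.exp (Complex.I * ((x - y : ℝ) : ℂ)) - 1) := by
    rw [mul_sub, ← Complex.exp_add, mul_one]
    push_cast
    ring_nf
  rw [h, norm_mul, Complex.norm_exp_ofReal_mul_I, one_mul]
  exact Real.norm_exp_I_mul_ofReal_sub_one_le

section CharFun

variable {α : Type*} [Fintype α]

/-- The characteristic function of `u` under the uniform distribution on `α`. -/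
noncomputable def uniformCharFun (u : α → ℝ) (s : ℝ) : ℂ :=
  (Fintype.card α : ℂ)⁻¹ * ∑ x, Complex.exp (((s * u x : ℝ) : ℂ) * Complex.I)

theorem norm_uniformCharFun_le (u : α → ℝ) (s : ℝ) : ‖uniformCharFun u s‖ ≤ 1 := by
  rw [uniformCharFun, norm_mul, norm_inv, Complex.norm_natCast]
  have h : ‖∑ x, Complex.exp (((s * u x : ℝ) : ℂ) * Complex.I)‖ ≤ Fintype.card α := by
    refine (norm_sum_le _ _).trans ?_
    simp only [Complex.norm_exp_ofReal_mul_I]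
    simp
  exact (mul_le_mul_of_nonneg_left h (by positivity)).trans (inv_mul_le_one)

theorem prod_uniformCharFun {n : ℕ} (u : α → ℝ) (s : Fin n → ℝ) :
    ∏ i, uniformCharFun u (s i) = ((Fintype.card α : ℂ) ^ n)⁻¹ *
      ∑ w : Fin n → α, Complex.exp (((∑ i, s i * u (w i) : ℝ) : ℂ) * Complex.I) := by
  classical
  simp only [uniformCharFun]
  rw [Finset.prod_mul_distrib, Finset.prod_univ_sum, Fintype.piFinset_univ]
  simp only [Finset.prod_const, Finset.card_univ, Fintype.card_fin, inv_pow]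
  congr 1
  refine Finset.sum_congr rfl fun w _ => ?_
  rw [← Complex.exp_sum, Complex.ofReal_sum, Finset.sum_mul]

/-- Both functions agree with 1 - v s²/2 up to |s|³: one by the cubic Taylor bound and the vanishing
mean, the other by the quadratic bound for the real exponential. -/
theorem norm_uniformCharFun_sub_exp_le [Nonempty α] {u : α → ℝ} (hu : ∀ x, |u x| ≤ 1)
    (hsum : ∑ x, u x = 0) {v : ℝ} (hv : ∑ x, u x ^ 2 = Fintype.card α * v) {s : ℝ} (hs : |s| ≤ 1) :
    ‖uniformCharFun u s - ((Real.exp (-(v * s ^ 2 / 2)) : ℝ) : ℂ)‖ ≤ 2 * |s| ^ 3 := by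
  have hcard : (0 : ℝ) < Fintype.card α := by exact_mod_cast Fintype.card_pos
  have hcardC : (Fintype.card α : ℂ) ≠ 0 := by exact_mod_cast hcard.ne'
  have hv0 : 0 ≤ v := by
    have : 0 ≤ ∑ x, u x ^ 2 := Finset.sum_nonneg fun x _ => sq_nonneg _
    rw [hv] at this
    exact nonneg_of_mul_nonneg_right this hcard
  have hv1 : v ≤ 1 := by
    have : ∑ x, u x ^ 2 ≤ ∑ _x : α, (1 : ℝ) :=
      Finset.sum_le_sum fun x _ => (sq_le_one_iff_abs_le_one _).2 (hu x)
    rw [hv] at this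
    simp only [Finset.sum_const, Finset.card_univ, nsmul_eq_mul] at this
    exact le_of_mul_le_mul_left this hcard
  have hs2 : s ^ 2 ≤ 1 := (sq_le_one_iff_abs_le_one _).2 hs
  have h1 : ‖uniformCharFun u s - ((1 - v * s ^ 2 / 2 : ℝ) : ℂ)‖ ≤ |s| ^ 3 := by
    have hsumC : ∑ x, (u x : ℂ) = 0 := by exact_mod_cast hsum
    have hvC : ∑ x, (u x : ℂ) ^ 2 = Fintype.card α * v := by exact_mod_cast hv
    have heq : uniformCharFun u s - ((1 - v * s ^ 2 / 2 : ℝ) : ℂ) = (Fintype.card α : ℂ)⁻¹ *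
        ∑ x, (Complex.exp (((s * u x : ℝ) : ℂ) * Complex.I) -
          (1 + s * Complex.I * u x - s ^ 2 / 2 * (u x : ℂ) ^ 2)) := by
      rw [Finset.sum_sub_distrib, Finset.sum_sub_distrib, Finset.sum_add_distrib, ← Finset.mul_sum,
        ← Finset.mul_sum, hsumC, hvC, uniformCharFun]
      simp only [Finset.sum_const, Finset.card_univ, nsmul_eq_mul]
      generalize ∑ x, Complex.exp (((s * u x : ℝ) : ℂ) * Complex.I) = S
      push_cast
      field_simp
      ring
    rw [heq, norm_mul, norm_inv, Complex.norm_natCast, inv_mul_le_iff₀ hcard]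
    refine (norm_sum_le _ _).trans ?_
    have hx : ∀ x ∈ Finset.univ, ‖Complex.exp (((s * u x : ℝ) : ℂ) * Complex.I) -
          (1 + s * Complex.I * u x - s ^ 2 / 2 * (u x : ℂ) ^ 2)‖ ≤ |s| ^ 3 := by
      intro x _
      have hz : ‖((s * u x : ℝ) : ℂ) * Complex.I‖ ≤ |s| := by
        rw [norm_mul, Complex.norm_I, mul_one, Complex.norm_real, Real.norm_eq_abs, abs_mul]
        exact mul_le_of_le_one_right (abs_nonneg _) (hu x)
      have := Complex.exp_bound (hz.trans hs) (n := 3) (by norm_num)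
      have he : ∑ m ∈ Finset.range 3, (((s * u x : ℝ) : ℂ) * Complex.I) ^ m / m.factorial =
          1 + s * Complex.I * u x - s ^ 2 / 2 * (u x : ℂ) ^ 2 := by
        simp only [Finset.sum_range_succ, Finset.sum_range_zero, Nat.factorial, mul_pow,
          Complex.I_sq]
        push_cast
        ring
      rw [he] at this
      refine this.trans ?_
      have h3 : ‖((s * u x : ℝ) : ℂ) * Complex.I‖ ^ 3 ≤ |s| ^ 3 :=
        pow_le_pow_left₀ (norm_nonneg _) hz 3
      refine (mul_le_of_le_one_right (by positivity) ?_).trans h3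
      -- The constant in `Complex.exp_bound` for order 3 is 4/18.
      norm_num [Nat.factorial]
    refine (Finset.sum_le_sum hx).trans ?_
    simp
  have h2 : ‖((1 - v * s ^ 2 / 2 : ℝ) : ℂ) - ((Real.exp (-(v * s ^ 2 / 2)) : ℝ) : ℂ)‖ ≤ |s| ^ 3 := by
    rw [← Complex.ofReal_sub, Complex.norm_real, Real.norm_eq_abs, abs_sub_comm]
    have hy0 : 0 ≤ v * s ^ 2 / 2 := by positivity
    have hy1 : v * s ^ 2 / 2 ≤ s ^ 2 := by nlinarith [sq_nonneg s]
    have := Real.abs_exp_sub_one_sub_id_le (x := -(v * s ^ 2 / 2))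
      (by rw [abs_neg, abs_of_nonneg hy0]; linarith)
    calc _ = |Real.exp (-(v * s ^ 2 / 2)) - 1 - -(v * s ^ 2 / 2)| := by congr 1; ring
      _ ≤ (-(v * s ^ 2 / 2)) ^ 2 := this
      _ = (v * s ^ 2 / 2) ^ 2 := by ring
      _ ≤ (s ^ 2) ^ 2 := pow_le_pow_left₀ hy0 hy1 2
      _ = |s| ^ 4 := by rw [← sq_abs s]; ring
      _ ≤ |s| ^ 3 := pow_le_pow_of_le_one (abs_nonneg _) hs (by norm_num)
  calc _ ≤ _ := norm_sub_le_norm_sub_add_norm_sub _ ((1 - v * s ^ 2 / 2 : ℝ) : ℂ) _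
    _ ≤ |s| ^ 3 + |s| ^ 3 := add_le_add h1 h2
    _ = _ := by ring

theorem norm_prod_uniformCharFun_sub_exp_le [Nonempty α] {u : α → ℝ} (hu : ∀ x, |u x| ≤ 1)
    (hsum : ∑ x, u x = 0) {v : ℝ} (hv : ∑ x, u x ^ 2 = Fintype.card α * v)
    {n : ℕ} {s : Fin n → ℝ} {δ : ℝ} (hδ : δ ≤ 1) (hs : ∀ i, |s i| ≤ δ) :
    ‖∏ i, uniformCharFun u (s i) - ((Real.exp (-(v * (∑ i, s i ^ 2) / 2)) : ℝ) : ℂ)‖ ≤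
      2 * (n * δ ^ 3) := by
  have hv0 : 0 ≤ v := by
    have : 0 ≤ ∑ x, u x ^ 2 := Finset.sum_nonneg fun x _ => sq_nonneg _
    rw [hv] at this
    exact nonneg_of_mul_nonneg_right this (by exact_mod_cast Fintype.card_pos)
  have he : Real.exp (-(v * (∑ i, s i ^ 2) / 2)) = ∏ i, Real.exp (-(v * s i ^ 2 / 2)) := by
    rw [← Real.exp_sum, Finset.sum_neg_distrib, ← Finset.sum_div, ← Finset.mul_sum]
  rw [he, Complex.ofReal_prod]
  refine (norm_prod_sub_prod_le _ (fun i _ => norm_uniformCharFun_le u _) fun i _ => ?_).trans ?_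
  · rw [Complex.norm_real, Real.norm_eq_abs, Real.abs_exp, Real.exp_le_one_iff, neg_nonpos]
    positivity
  · have : ∀ i ∈ Finset.univ, ‖uniformCharFun u (s i) -
        ((Real.exp (-(v * s i ^ 2 / 2)) : ℝ) : ℂ)‖ ≤ 2 * δ ^ 3 := fun i _ =>
      (norm_uniformCharFun_sub_exp_le hu hsum hv ((hs i).trans hδ)).trans
        (mul_le_mul_of_nonneg_left (pow_le_pow_left₀ (abs_nonneg _) (hs i) 3) (by norm_num))
    refine (Finset.sum_le_sum this).trans (le_of_eq ?_)
    simp only [Finset.sum_const, Finset.card_univ, Fintype.card_fin, nsmul_eq_mul]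
    ring

end CharFun

/-! ### The limit theorem -/

theorem integral_aShuffle {n a : ℕ} [NeZero a] (f : Equiv.Perm (Fin n) → ℂ) :
    ∫ σ, f σ ∂(aShuffle n a).toMeasure =
      ((a : ℂ) ^ n)⁻¹ * ∑ w : Fin n → Fin a, f (Tuple.sort w).symm := by
  have : DiscreteMeasurableSpace (Equiv.Perm (Fin n)) := ⟨fun _ => trivial⟩
  have hm : Measurable fun w : Fin n → Fin a => (Tuple.sort w).symm := .of_discrete
  rw [aShuffle_eq_map_sort, ← PMF.toMeasure_map _ _ hm,
    integral_map hm.aemeasurable (Measurable.of_discrete.aestronglyMeasurable),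
    PMF.integral_eq_sum, Finset.mul_sum]
  refine Finset.sum_congr rfl fun w _ => ?_
  simp [PMF.uniformOfFintype_apply]

section Estimates

variable {n a : ℕ} [NeZero a]

/-- Dropping the remainder costs at most |r| times its L¹ norm, as x ↦ exp(ix) is 1-Lipschitz;
Cauchy–Schwarz bounds that norm by the L² bound 3n. -/
theorem norm_charFun_inversions_sub_prod_le (r : ℝ) :
    ‖((a : ℂ) ^ n)⁻¹ * ∑ w : Fin n → Fin a, Complex.exp
        (((r * ((invCount w : ℝ) - (n : ℝ) * ((n : ℝ) - 1) / 4 * (((a : ℝ) - 1) / a)) : ℝ) : ℂ) *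
          Complex.I) -
      ∏ i : Fin n, uniformCharFun (centeredLetter (a := a)) (r * ((n : ℝ) - 1 - 2 * (i : ℕ)))‖ ≤
      |r| * (n * 3) := by
  have ha : (0 : ℝ) < (a : ℝ) ^ n := pow_pos (by exact_mod_cast Nat.pos_of_neZero a) n
  rw [prod_uniformCharFun, Fintype.card_fin, ← mul_sub, ← Finset.sum_sub_distrib, norm_mul,
    norm_inv, norm_pow, Complex.norm_natCast, inv_mul_le_iff₀ ha]
  set R : (Fin n → Fin a) → ℝ := fun w =>
    ∑ p ∈ increasingPairs n, descentRemainder (w p.1) (w p.2) with hR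
  have hsq := sum_sq_degenerate_le (n := n) (sum_descentRemainder_left (a := a))
    sum_descentRemainder_right abs_descentRemainder_le
  have hL1 : ∑ w, |R w| ≤ (a : ℝ) ^ n * (n * 3) := by
    refine le_of_sq_le_sq ?_ (by positivity)
    calc (∑ w, |R w|) ^ 2 ≤ (Finset.univ : Finset (Fin n → Fin a)).card * ∑ w, |R w| ^ 2 :=
          sq_sum_le_card_mul_sum_sq
      _ = (a : ℝ) ^ n * ∑ w, R w ^ 2 := by simp
      _ ≤ (a : ℝ) ^ n * ((a : ℝ) ^ n * ((n : ℝ) * 3) ^ 2) := by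
          rw [Fintype.card_fin] at hsq
          exact mul_le_mul_of_nonneg_left hsq ha.le
      _ = _ := by ring
  calc _ ≤ ∑ w, |r| * |R w| := by
        refine (norm_sum_le _ _).trans (Finset.sum_le_sum fun w _ => ?_)
        refine (norm_exp_mul_I_sub_exp_mul_I_le _ _).trans (le_of_eq ?_)
        rw [invCount_word_eq, ← abs_mul, mul_add, Finset.mul_sum]
        congr 1
        simp only [mul_assoc]
        ring
    _ = |r| * ∑ w, |R w| := by rw [Finset.mul_sum]
    _ ≤ |r| * ((a : ℝ) ^ n * (n * 3)) := mul_le_mul_of_nonneg_left hL1 (abs_nonneg _)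
    _ = _ := by ring

theorem sum_linear_weights_sq (n : ℕ) :
    ∑ i : Fin n, ((n : ℝ) - 1 - 2 * (i : ℕ)) ^ 2 = n * ((n : ℝ) ^ 2 - 1) / 3 := by
  have h : ∀ i : Fin n, ((n : ℝ) - 1 - 2 * (i : ℕ)) ^ 2 =
      ((n : ℝ) - 1) ^ 2 - 4 * ((n : ℝ) - 1) * (i : ℕ) + 4 * ((i : ℕ) : ℝ) ^ 2 := fun i => by ring
  rw [Finset.sum_congr rfl fun i _ => h i, Finset.sum_add_distrib, Finset.sum_sub_distrib,
    ← Finset.mul_sum, ← Finset.mul_sum, Fin.sum_univ_eq_sum_range (fun i => (i : ℝ)),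
    Fin.sum_univ_eq_sum_range (fun i => (i : ℝ) ^ 2), sum_range_natCast, sum_range_natCast_sq]
  simp only [Finset.sum_const, Finset.card_univ, Fintype.card_fin, nsmul_eq_mul]
  ring

theorem norm_prod_linear_weights_sub_exp_le {r : ℝ} (hr : |r| * n ≤ 1) :
    ‖∏ i : Fin n, uniformCharFun (centeredLetter (a := a)) (r * ((n : ℝ) - 1 - 2 * (i : ℕ))) -
      ((Real.exp (-(((a : ℝ) ^ 2 - 1) / (12 * (a : ℝ) ^ 2) *
        (r ^ 2 * (n * ((n : ℝ) ^ 2 - 1) / 3)) / 2)) : ℝ) : ℂ)‖ ≤ 2 * (n * (|r| * n) ^ 3) := by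
  have := norm_prod_uniformCharFun_sub_exp_le (u := centeredLetter (a := a))
    (fun x => (abs_centeredLetter_le x).trans (by norm_num)) sum_centeredLetter
    (by rw [Fintype.card_fin]; exact sum_centeredLetter_sq)
    (s := fun i : Fin n => r * ((n : ℝ) - 1 - 2 * (i : ℕ))) hr (fun i => by
      rw [abs_mul]
      refine mul_le_mul_of_nonneg_left ?_ (abs_nonneg _)
      have h1 : ((i : ℕ) : ℝ) + 1 ≤ n := by exact_mod_cast i.2
      have h0 : (0 : ℝ) ≤ (i : ℕ) := by positivity
      rw [abs_le]
      constructor <;> linarith)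
  simp only [mul_pow] at this
  rw [← Finset.mul_sum, sum_linear_weights_sq] at this
  simpa only [mul_pow] using this

end Estimates

theorem tendsto_charFun_inversions (a : ℕ) [NeZero a] (ha : 2 ≤ a) (t : ℝ) :
    Tendsto (fun n : ℕ => ((a : ℂ) ^ n)⁻¹ * ∑ w : Fin n → Fin a, Complex.exp
        (((t / (Real.sqrt n * ((n : ℝ) - 1) *
            Real.sqrt (((a : ℝ) ^ 2 - 1) / (36 * (a : ℝ) ^ 2))) *
          ((invCount w : ℝ) - (n : ℝ) * ((n : ℝ) - 1) / 4 * (((a : ℝ) - 1) / a)) : ℝ) : ℂ) *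
          Complex.I)) atTop (nhds ((Real.exp (-(t ^ 2 / 2)) : ℝ) : ℂ)) := by
  have haR : (2 : ℝ) ≤ a := by exact_mod_cast ha
  have hv : 0 < ((a : ℝ) ^ 2 - 1) / (36 * (a : ℝ) ^ 2) := div_pos (by nlinarith) (by positivity)
  set c : ℝ := Real.sqrt (((a : ℝ) ^ 2 - 1) / (36 * (a : ℝ) ^ 2)) with hc
  have hc0 : 0 < c := Real.sqrt_pos.2 hv
  -- The factor 3 cancels the 1/3 in the sum of squared weights.
  have hc2 : ((a : ℝ) ^ 2 - 1) / (12 * (a : ℝ) ^ 2) = 3 * c ^ 2 := by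
    rw [hc, Real.sq_sqrt hv.le]
    field_simp
    ring
  set r : ℕ → ℝ := fun n => t / (Real.sqrt n * ((n : ℝ) - 1) * c) with hr
  have hinv : Tendsto (fun n : ℕ => (Real.sqrt n)⁻¹) atTop (nhds 0) :=
    tendsto_inv_atTop_zero.comp (Real.tendsto_sqrt_atTop.comp tendsto_natCast_atTop_atTop)
  have hq : Tendsto (fun n : ℕ => (n : ℝ) / ((n : ℝ) + (-1))) atTop (nhds 1) :=
    tendsto_natCast_div_add_atTop (-1)
  have hrn : ∀ᶠ n : ℕ in atTop,
      |r n| * n = |t| / c * ((n : ℝ) / ((n : ℝ) + (-1))) * (Real.sqrt n)⁻¹ := by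
    filter_upwards [eventually_ge_atTop 2] with n hn
    have hn' : (2 : ℝ) ≤ n := by exact_mod_cast hn
    have hs : 0 < Real.sqrt n := Real.sqrt_pos.2 (by linarith)
    have h1 : (0 : ℝ) < (n : ℝ) - 1 := by linarith
    rw [hr]
    dsimp only
    rw [abs_div, abs_of_pos (mul_pos (mul_pos hs h1) hc0), ← sub_eq_add_neg]
    field_simp
  have hlim1 : Tendsto (fun n : ℕ => |r n| * n) atTop (nhds 0) := by
    have := (hq.const_mul (|t| / c)).mul hinv
    rw [mul_zero] at this
    exact this.congr' (hrn.mono fun _ h => h.symm)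
  -- Here |r| n is of order n^(-1/2), so the sum of n cubic errors is again of order n^(-1/2).
  have hlim2 : Tendsto (fun n : ℕ => (n : ℝ) * (|r n| * n) ^ 3) atTop (nhds 0) := by
    have := ((hq.const_mul (|t| / c)).pow 3).mul hinv
    rw [mul_zero] at this
    refine this.congr' ?_
    filter_upwards [hrn, eventually_ge_atTop 1] with n h hn
    have hn' : (0 : ℝ) < n := by exact_mod_cast hn
    have hs : 0 < Real.sqrt n := Real.sqrt_pos.2 hn'
    have hss : (n : ℝ) = Real.sqrt n ^ 2 := (Real.sq_sqrt hn'.le).symm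
    rw [h, mul_pow _ (Real.sqrt n)⁻¹]
    have : (Real.sqrt n)⁻¹ = n * (Real.sqrt n)⁻¹ ^ 3 := by
      nth_rw 2 [hss]
      field_simp
    nth_rw 1 [this]
    ring
  have hlim3 : Tendsto (fun n : ℕ => ((Real.exp (-(((a : ℝ) ^ 2 - 1) / (12 * (a : ℝ) ^ 2) *
      (r n ^ 2 * (n * ((n : ℝ) ^ 2 - 1) / 3)) / 2)) : ℝ) : ℂ)) atTop
      (nhds ((Real.exp (-(t ^ 2 / 2)) : ℝ) : ℂ)) := by
    -- The exact variance ratio is (n + 1)/(n - 1) = 2n/(n - 1) - 1.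
    have h : Tendsto (fun n : ℕ => t ^ 2 * (2 * ((n : ℝ) / ((n : ℝ) + (-1))) - 1)) atTop
        (nhds (t ^ 2)) := by
      have := ((hq.const_mul 2).sub_const 1).const_mul (t ^ 2)
      norm_num at this
      simpa using this
    have h' : Tendsto (fun n : ℕ => ((a : ℝ) ^ 2 - 1) / (12 * (a : ℝ) ^ 2) *
        (r n ^ 2 * (n * ((n : ℝ) ^ 2 - 1) / 3))) atTop (nhds (t ^ 2)) := by
      refine h.congr' ?_
      filter_upwards [eventually_ge_atTop 2] with n hn
      have hn' : (2 : ℝ) ≤ n := by exact_mod_cast hn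
      have h1 : (n : ℝ) - 1 ≠ 0 := by linarith
      rw [hc2, hr]
      dsimp only
      rw [div_pow, mul_pow, mul_pow, Real.sq_sqrt n.cast_nonneg, ← sub_eq_add_neg]
      field_simp
      ring
    exact ((Complex.continuous_ofReal.comp Real.continuous_exp).tendsto _).comp
      (h'.div_const 2).neg
  have hbound : Tendsto (fun n : ℕ => |r n| * (n * 3) + 2 * ((n : ℝ) * (|r n| * n) ^ 3)) atTop
      (nhds 0) := by
    have := (hlim1.mul_const 3).add (hlim2.const_mul 2)
    simpa only [mul_assoc, zero_mul, mul_zero, add_zero] using this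
  refine tendsto_of_tendsto_of_dist hlim3 (squeeze_zero' (Eventually.of_forall fun _ => dist_nonneg)
    ?_ hbound)
  -- The Taylor estimate needs all scaled weights to be at most 1, which holds for large n.
  filter_upwards [hlim1.eventually_le_const (zero_lt_one' ℝ)] with n hn
  rw [dist_comm, dist_eq_norm]
  exact (norm_sub_le_norm_sub_add_norm_sub _ _ _).trans
    (add_le_add (norm_charFun_inversions_sub_prod_le (r n)) (norm_prod_linear_weights_sub_exp_le hn))

theorem theorem8p2 (a : ℕ) [NeZero a] (ha : 2 ≤ a)
    {Ω : ℕ → Type*} [∀ n, MeasurableSpace (Ω n)]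
    (P : ∀ n, Measure (Ω n)) [∀ n, IsProbabilityMeasure (P n)]
    (ρ : ∀ n, Ω n → Equiv.Perm (Fin n))
    (hρ : ∀ n, HasLaw (ρ n) (aShuffle n a).toMeasure (P n))
    {Ω' : Type*} [MeasurableSpace Ω'] (P' : Measure Ω') [IsProbabilityMeasure P']
    (G : Ω' → ℝ) (hG : HasLaw G (gaussianReal 0 1) P') :
    TendstoInDistribution
      (fun (n : ℕ) (ω : Ω n) =>
        ((invCount (ρ n ω) : ℝ) - (n : ℝ) * ((n : ℝ) - 1) / 4 * (((a : ℝ) - 1) / a)) /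
          (Real.sqrt n * ((n : ℝ) - 1) * Real.sqrt (((a : ℝ) ^ 2 - 1) / (36 * (a : ℝ) ^ 2))))
      atTop G P P' := by
  have hd : ∀ n, DiscreteMeasurableSpace (Equiv.Perm (Fin n)) := fun n => ⟨fun _ => trivial⟩
  have hmeas : ∀ n, AEMeasurable (fun (ω : Ω n) =>
        ((invCount (ρ n ω) : ℝ) - (n : ℝ) * ((n : ℝ) - 1) / 4 * (((a : ℝ) - 1) / a)) /
          (Real.sqrt n * ((n : ℝ) - 1) * Real.sqrt (((a : ℝ) ^ 2 - 1) / (36 * (a : ℝ) ^ 2))))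
      (P n) := fun n =>
    (Measurable.of_discrete (f := fun σ : Equiv.Perm (Fin n) =>
      ((invCount σ : ℝ) - (n : ℝ) * ((n : ℝ) - 1) / 4 * (((a : ℝ) - 1) / a)) /
        (Real.sqrt n * ((n : ℝ) - 1) *
          Real.sqrt (((a : ℝ) ^ 2 - 1) / (36 * (a : ℝ) ^ 2))))).comp_aemeasurable (hρ n).aemeasurable
  refine ⟨hmeas, hG.aemeasurable, ProbabilityMeasure.tendsto_iff_tendsto_charFun.2 fun t => ?_⟩
  have hlim : charFun (P'.map G) t = ((Real.exp (-(t ^ 2 / 2)) : ℝ) : ℂ) := by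
    rw [hG.map_eq, charFun_gaussianReal]
    push_cast
    congr 1
    simp
  simp only [ProbabilityMeasure.coe_mk]
  rw [hlim]
  refine (tendsto_charFun_inversions a ha t).congr fun n => ?_
  rw [charFun_apply_real, integral_map (hmeas n) (by fun_prop)]
  have hcomp := integral_map (hρ n).aemeasurable (f := fun σ : Equiv.Perm (Fin n) =>
    Complex.exp ((t : ℂ) * ((((invCount σ : ℝ) -
      (n : ℝ) * ((n : ℝ) - 1) / 4 * (((a : ℝ) - 1) / a)) /
        (Real.sqrt n * ((n : ℝ) - 1) *
          Real.sqrt (((a : ℝ) ^ 2 - 1) / (36 * (a : ℝ) ^ 2))) : ℝ) : ℂ) * Complex.I))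
    Measurable.of_discrete.aestronglyMeasurable
  rw [← hcomp, (hρ n).map_eq, integral_aShuffle]
  congr 1
  refine Finset.sum_congr rfl fun w _ => ?_
  rw [invCount_sort_symm]
  push_cast
  congr 2
  ring
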